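/- In a two-player $m\times m$ identical-interest game with payoff matrix $A\in\mathbb{R}^{m\times m}$, both players receive $\langle x, A y\rangle$ under mixed strategies $x,y\in\Delta_m=\{z\in\mathbb{R}^m_{\ge 0}:\sum_a z[a]=1\}$; a profile $(x,y)$ is an $\epsilon$-Nash equilibrium if $\langle x',Ay\rangle\le\langle x,Ay\rangle+\epsilon$ and $\langle x,Ay'\rangle\le\langle x,Ay\rangle+\epsilon$ for all $x',y'\in\Delta_m$. Simultaneous regret matching ($\mathtt{RM}$) started at $(x_1^{(0)},x_2^{(0)})$ sets $r_1^{(0)}=r_2^{(0)}=0$ and, in each round $t=1,2,\dots$, each player $i$ plays $x_i^{(t)}=[r_i^{(t-1)}]^+/\|[r_i^{(t-1)}]^+\|_1$ if $[r_i^{(t-1)}]^+\neq 0$ and $x_i^{(t)}=x_i^{(t-1)}$ otherwise, and then updates $r_i^{(t)}=r_i^{(t-1)}+u_i^{(t)}-\langle x_i^{(t)},u_i^{(t)}\rangle\mathbf{1}$, where $u_1^{(t)}=Ax_2^{(t)}$ and $u_2^{(t)}=A^\top x_1^{(t)}$. There are an absolute constant $c>0$ and an $m_0$ such that for every $m\ge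 m_0$ there is a two-player $m\times m$ identical-interest game, with all payoffs at most $m-1$ in absolute value, in which simultaneous $\mathtt{RM}$, with both players initialized at the uniform strategy, requires at least $m^{cm}$ rounds to reach a $\frac{1}{m+1}$-Nash equilibrium: for every round $t$ with $1\le t<m^{cm}$, the profile $(x_1^{(t)},x_2^{(t)})$ is not a $\frac{1}{m+1}$-Nash equilibrium. In particular, simultaneous $\mathtt{RM}$ requires $m^{\Omega(m)}$ rounds to converge to a $\frac{1}{m+1}$-Nash equilibrium in two-player $m\times m$ identical-interest games, even when both players initialize at the uniform random strategy. -/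

import Mathlib

open scoped Matrix

noncomputable section

namespace RegretMatching

variable {ι κ : Type*} [Fintype ι] [Fintype κ]

/-- The expected common payoff `⟨x, A y⟩` of a two-player identical-interest game with payoff
matrix `A`, under the mixed strategies `x` (row player) and `y` (column player). -/
def payoff (A : Matrix ι κ ℝ) (x : stdSimplex ℝ ι) (y : stdSimplex ℝ κ) : ℝ :=
  x.1 ⬝ᵥ (A *ᵥ y.1)

/-- The profile `(x, y)` is an `ε`-Nash equilibrium of the two-player identical-interest game with
payoff matrix `A`: no unilateral deviation to a mixed strategy gains more than `ε`. -/
def IsApproxNash (A : Matrix ι κ ℝ) (ε : ℝ) (x : stdSimplex ℝ ι) (y : stdSimplex ℝ κ) : Prop :=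
  (∀ x' : stdSimplex ℝ ι, payoff A x' y ≤ payoff A x y + ε) ∧
    (∀ y' : stdSimplex ℝ κ, payoff A x y' ≤ payoff A x y + ε)

/-- The coordinatewise nonnegative part of a regret vector. -/
def nonnegPart (r : ι → ℝ) : ι → ℝ := fun a => max 0 (r a)

theorem normalize_mem_stdSimplex (r : ι → ℝ) (h : nonnegPart r ≠ 0) :
    (fun a => nonnegPart r a / ∑ b, nonnegPart r b) ∈ stdSimplex ℝ ι := by
  have h0 : ∀ a, 0 ≤ nonnegPart r a := fun a => le_max_left _ _
  refine ⟨fun a => div_nonneg (h0 a) (Finset.sum_nonneg fun b _ => h0 b), ?_⟩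
  rw [← Finset.sum_div]
  refine div_self fun hs => h (funext fun a => ?_)
  exact (Finset.sum_eq_zero_iff_of_nonneg fun b _ => h0 b).1 hs a (Finset.mem_univ a)

/-- What a regret-matching learner stores between rounds: the cumulative regrets (untruncated) and
the last strategy played. -/
structure State (ι : Type*) [Fintype ι] where
  regret : ι → ℝ
  strategy : stdSimplex ℝ ι

/-- The strategy that regret matching plays next: proportional to the nonnegative part of the
cumulative regrets if this is nonzero, and otherwise the previous strategy. -/
def State.nextStrategy (s : State ι) : stdSimplex ℝ ι :=
  if h : nonnegPart s.regret = 0 then s.strategy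
  else ⟨fun a => nonnegPart s.regret a / ∑ b, nonnegPart s.regret b,
    normalize_mem_stdSimplex s.regret h⟩

/-- The state after playing `x` and observing the utility vector `u`: each action's regret
increases by its utility minus the utility `⟨x, u⟩` obtained. -/
def State.observe (s : State ι) (x : stdSimplex ℝ ι) (u : ι → ℝ) : State ι where
  regret := fun a => s.regret a + u a - x.1 ⬝ᵥ u
  strategy := x

/-- Simultaneous regret matching, by both players, in the identical-interest game with payoff
matrix `A`, from zero regrets and the initial strategies `x₀`, `y₀`: the pair of states after `t`
rounds. In each round both players first choose their strategies `x`, `y`, and then the row player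
observes `A y` and the column player observes `Aᵀ x`. -/
def simultaneousRM (A : Matrix ι κ ℝ) (x₀ : stdSimplex ℝ ι) (y₀ : stdSimplex ℝ κ) :
    ℕ → State ι × State κ
  | 0 => (⟨0, x₀⟩, ⟨0, y₀⟩)
  | t + 1 =>
    let s := simultaneousRM A x₀ y₀ t
    let x := s.1.nextStrategy
    let y := s.2.nextStrategy
    (s.1.observe x (A *ᵥ y.1), s.2.observe y (Aᵀ *ᵥ x.1))

/-- The strategy of the row player in round `t` (the initial strategy if `t = 0`). -/
def rowStrategy (A : Matrix ι κ ℝ) (x₀ : stdSimplex ℝ ι) (y₀ : stdSimplex ℝ κ) (t : ℕ) :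
    stdSimplex ℝ ι :=
  (simultaneousRM A x₀ y₀ t).1.strategy

/-- The strategy of the column player in round `t` (the initial strategy if `t = 0`). -/
def colStrategy (A : Matrix ι κ ℝ) (x₀ : stdSimplex ℝ ι) (y₀ : stdSimplex ℝ κ) (t : ℕ) :
    stdSimplex ℝ κ :=
  (simultaneousRM A x₀ y₀ t).2.strategy

/-- The uniform mixed strategy. -/
def uniformStrategy (ι : Type*) [Fintype ι] [Nonempty ι] : stdSimplex ℝ ι :=
  stdSimplex.barycenter

end RegretMatching

end

/-! ### Reduction to self-play, and a priori bounds on regrets. -/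

namespace RegretMatching

variable {ι : Type*} [Fintype ι]

/-! The game is symmetric and both players start alike, so they stay identical and a single regret
vector describes the play. It climbs a staircase of actions `c 0, c 1, …` in stages. While only `c
j` is played (`Pure`), `c (j + 1)` gains regret 1 per round, but `c (j + 2)` loses at least `v`,
since its payoff against `c j` is 0. Hence if `c (j + 1)` starts in debt `D`, then `c (j + 2)` is in
debt about `v * D` once `c (j + 1)` gets played. The two actions `c j` and `c (j + 1)` are then
mixed (`Mixed`) until `c j` drops out. This takes only O(j) rounds, by an energy argument, and costs
at most half of the debt. So debts grow by a factor `v / 2` per stage.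

Regrets change by at most `2 * B` per round when payoffs are bounded by `B`, so a debt of `(v / 2) ^
n` certifies that at least `(v / 2) ^ n / (2 * B)` rounds have passed. Until then one of the next
two steps of the staircase is a profitable deviation. Taking `v` and `n` linear in `m` gives `m ^
Ω(m)`.

For the uniform start to lead to `c 0`, all other rows must have sum 0. Spare actions off the
staircase absorb the row sums without changing the staircase entries. -/

/-- One round of regret matching against a copy of oneself. -/
noncomputable def State.selfPlay (A : Matrix ι ι ℝ) (s : State ι) : State ι :=
  s.observe s.nextStrategy (A *ᵥ s.nextStrategy.1)

theorem simultaneousRM_of_isSymm {A : Matrix ι ι ℝ} (hA : Aᵀ = A) (x₀ : stdSimplex ℝ ι) (t : ℕ) :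
    simultaneousRM A x₀ x₀ t =
      ((State.selfPlay A)^[t] ⟨0, x₀⟩, (State.selfPlay A)^[t] ⟨0, x₀⟩) := by
  induction t with
  | zero => rfl
  | succ t ih =>
    rw [Function.iterate_succ_apply']
    simp only [simultaneousRM, ih, hA]
    rfl

theorem not_isApproxNash_self [DecidableEq ι] {A : Matrix ι ι ℝ} {ε : ℝ} {x : stdSimplex ℝ ι}
    (i : ι) (h : x.1 ⬝ᵥ (A *ᵥ x.1) + ε < (A *ᵥ x.1) i) : ¬ IsApproxNash A ε x x := by
  intro hN
  have := hN.1 ⟨Pi.single i 1, single_mem_stdSimplex ℝ i⟩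
  simp only [payoff, single_dotProduct, one_mul] at this
  linarith

theorem abs_dotProduct_le_of_mem_stdSimplex {x u : ι → ℝ} {B : ℝ} (hx : x ∈ stdSimplex ℝ ι)
    (hu : ∀ i, |u i| ≤ B) : |x ⬝ᵥ u| ≤ B := by
  calc |x ⬝ᵥ u| ≤ ∑ i, |x i * u i| := Finset.abs_sum_le_sum_abs _ _
    _ ≤ ∑ i, x i * B := by
        refine Finset.sum_le_sum fun i _ => ?_
        rw [abs_mul, abs_of_nonneg (hx.1 i)]
        exact mul_le_mul_of_nonneg_left (hu i) (hx.1 i)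
    _ = B := by rw [← Finset.sum_mul, hx.2, one_mul]

theorem abs_mulVec_le {A : Matrix ι ι ℝ} {B : ℝ} (hA : ∀ i j, |A i j| ≤ B)
    (x : stdSimplex ℝ ι) (i : ι) : |(A *ᵥ x.1) i| ≤ B := by
  rw [Matrix.mulVec, dotProduct_comm]
  exact abs_dotProduct_le_of_mem_stdSimplex x.2 (hA i)

/-- Serves as the clock: a large debt can only come from many rounds, so stage lengths need not be
counted. -/
theorem le_regret_iterate_selfPlay {A : Matrix ι ι ℝ} {B : ℝ} (hA : ∀ i j, |A i j| ≤ B)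
    (x₀ : stdSimplex ℝ ι) (t : ℕ) (i : ι) :
    -(2 * B * t) ≤ ((State.selfPlay A)^[t] ⟨0, x₀⟩).regret i := by
  induction t with
  | zero => simp
  | succ t ih =>
    rw [Function.iterate_succ_apply']
    set s := (State.selfPlay A)^[t] ⟨0, x₀⟩
    have h1 := abs_le.1 (abs_mulVec_le hA s.nextStrategy i)
    have h2 := abs_le.1 (abs_dotProduct_le_of_mem_stdSimplex s.nextStrategy.2
      (abs_mulVec_le hA s.nextStrategy))
    simp only [State.selfPlay, State.observe]
    push_cast
    linarith [h1.1, h2.2]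

/-- Regret matching mixes only two actions if all other regrets are nonpositive. -/
theorem nextStrategy_eq_of_two [DecidableEq ι] {s : State ι} {a b : ι} (hab : a ≠ b)
    (ha : 0 < s.regret a) (h : ∀ i, i ≠ a → i ≠ b → s.regret i ≤ 0) :
    s.nextStrategy.1 =
      (Pi.single a (s.regret a / (s.regret a + max 0 (s.regret b))) +
        Pi.single b (max 0 (s.regret b) / (s.regret a + max 0 (s.regret b))) : ι → ℝ) := by
  have hn : nonnegPart s.regret =
      (Pi.single a (s.regret a) + Pi.single b (max 0 (s.regret b)) : ι → ℝ) := by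
    funext i
    by_cases hia : i = a
    · subst hia; simp [nonnegPart, Pi.single_eq_of_ne hab, ha.le]
    by_cases hib : i = b
    · subst hib; simp [nonnegPart, Pi.single_eq_of_ne hia]
    · simp [nonnegPart, hia, hib, h i hia hib]
  have h0 : nonnegPart s.regret ≠ 0 := fun h0 => by
    have := congrFun h0 a
    simp [nonnegPart, ha.not_ge] at this
  have hs : ∑ i, nonnegPart s.regret i = s.regret a + max 0 (s.regret b) := by
    simp [hn, Finset.sum_add_distrib]
  rw [State.nextStrategy, dif_neg h0]
  funext i
  simp only [hs]
  rw [hn]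
  simp only [Pi.add_apply, add_div, Pi.single_apply, ite_div, zero_div]

theorem mulVec_two [DecidableEq ι] (A : Matrix ι ι ℝ) (a b : ι) (p q : ℝ) (i : ι) :
    (A *ᵥ (Pi.single a p + Pi.single b q : ι → ℝ)) i = p * A i a + q * A i b := by
  simp [Matrix.mulVec_add]

theorem two_dotProduct [DecidableEq ι] (u : ι → ℝ) (a b : ι) (p q : ℝ) :
    (Pi.single a p + Pi.single b q : ι → ℝ) ⬝ᵥ u = p * u a + q * u b := by
  simp [add_dotProduct]

/-! ### Staircases: one round of play and the invariants of a stage. -/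

/-- The payoffs increase along the staircase `(c 0, c 0), (c 0, c 1), (c 1, c 1), …`, by one per
step, and no other deviation from a diagonal profile is profitable. -/
structure IsStaircase (A : Matrix ι ι ℝ) (c : ℕ → ι) (v : ℝ) (L : ℕ) : Prop where
  injOn : Set.InjOn c (Set.Iio L)
  diag : ∀ j, j < L → A (c j) (c j) = v + 2 * j
  right : ∀ j, j + 1 < L → A (c j) (c (j + 1)) = v + 2 * j + 1
  left : ∀ j, j + 1 < L → A (c (j + 1)) (c j) = v + 2 * j + 1
  far : ∀ j, j + 2 < L → A (c (j + 2)) (c j) = 0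
  le : ∀ j, j + 1 < L → ∀ i, i ≠ c (j + 1) → A i (c j) ≤ v + 2 * j

namespace IsStaircase

variable {A : Matrix ι ι ℝ} {c : ℕ → ι} {v : ℝ} {L : ℕ}

omit [Fintype ι] in
theorem ne (hA : IsStaircase A c v L) {i j : ℕ} (hi : i < L) (hj : j < L) (hij : i ≠ j) :
    c i ≠ c j := fun h => hij (hA.injOn hi hj h)

/-- One round from a state where only `c j` and possibly `c (j + 1)` have positive regret. -/
theorem selfPlay_two (hA : IsStaircase A c v L) {s : State ι} {j : ℕ} (hj : j + 2 < L)
    (ha : 0 < s.regret (c j)) (h : ∀ i, i ≠ c j → i ≠ c (j + 1) → s.regret i ≤ 0) :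
    ∃ p q : ℝ, p = s.regret (c j) / (s.regret (c j) + max 0 (s.regret (c (j + 1)))) ∧
      q = max 0 (s.regret (c (j + 1))) / (s.regret (c j) + max 0 (s.regret (c (j + 1)))) ∧
      p + q = 1 ∧ 0 ≤ p ∧ 0 ≤ q ∧
      s.nextStrategy.1 ⬝ᵥ (A *ᵥ s.nextStrategy.1) = v + 2 * j + 2 * q ∧
      (A *ᵥ s.nextStrategy.1) (c j) = v + 2 * j + q ∧
      (A *ᵥ s.nextStrategy.1) (c (j + 1)) = v + 2 * j + 1 + q ∧
      (A *ᵥ s.nextStrategy.1) (c (j + 2)) = q * (v + 2 * j + 3) ∧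
      ∀ i, i ≠ c (j + 1) → i ≠ c (j + 2) → (A *ᵥ s.nextStrategy.1) i ≤ v + 2 * j + 2 * q := by
  classical
  set a := s.regret (c j)
  set b := max 0 (s.regret (c (j + 1)))
  have hb : 0 ≤ b := le_max_left _ _
  have hx := nextStrategy_eq_of_two (hA.ne (by omega) (by omega) (by omega)) ha h
  have hpq : a / (a + b) + b / (a + b) = 1 := by
    rw [← add_div]; exact div_self (by positivity)
  have hp : 0 ≤ a / (a + b) := by positivity
  have hq : 0 ≤ b / (a + b) := by positivity
  refine ⟨a / (a + b), b / (a + b), rfl, rfl, hpq, hp, hq, ?_⟩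
  simp only [hx, mulVec_two, two_dotProduct]
  have e1 := hA.diag j (by omega)
  have e2 := hA.diag (j + 1) (by omega)
  have e3 := hA.right j (by omega)
  have e4 := hA.left j (by omega)
  have e5 := hA.left (j + 1) (by omega)
  have e6 := hA.far j (by omega)
  have e7 := hA.le j (by omega)
  have e8 := hA.le (j + 1) (by omega)
  push_cast at e2 e5 e8
  change (a / (a + b)) * ((a / (a + b)) * _ + (b / (a + b)) * _) + (b / (a + b)) * _ = _ ∧ _
  rw [e1, e2, e3, e4, e5, e6]
  generalize a / (a + b) = p at *
  generalize b / (a + b) = q at *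
  obtain rfl : p = 1 - q := by linarith
  refine ⟨by ring, by ring, by ring, by ring, fun i h1 h2 => ?_⟩
  have := mul_le_mul_of_nonneg_left (e7 i h1) hp
  have := mul_le_mul_of_nonneg_left (e8 i h2) hq
  linarith

theorem selfPlay_regret_le (hA : IsStaircase A c v L) {s : State ι} {j : ℕ} (hj : j + 2 < L)
    (ha : 0 < s.regret (c j)) (h : ∀ i, i ≠ c j → i ≠ c (j + 1) → s.regret i ≤ 0) {i : ι}
    (h1 : i ≠ c (j + 1)) (h2 : i ≠ c (j + 2)) :
    (s.selfPlay A).regret i ≤ s.regret i := by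
  obtain ⟨p, q, -, -, -, -, -, hobt, -, -, -, hle⟩ := hA.selfPlay_two hj ha h
  simp only [State.selfPlay, State.observe, hobt]
  linarith [hle i h1 h2]

/-- Moving to `c (j + 1)` gains exactly `p`, the weight of `c j`. If `p ≤ ε`, play is almost pure on
`c (j + 1)`, and moving to `c (j + 2)` gains `1 - p * (v + 2 * j + 1)`. -/
theorem not_isApproxNash (hA : IsStaircase A c v L) (hv : 0 ≤ v) {s : State ι} {j : ℕ}
    (hj : j + 2 < L)
    (ha : 0 < s.regret (c j)) (h : ∀ i, i ≠ c j → i ≠ c (j + 1) → s.regret i ≤ 0) {ε : ℝ}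
    (hε : ε * (v + 2 * j + 2) < 1) : ¬ IsApproxNash A ε s.nextStrategy s.nextStrategy := by
  classical
  obtain ⟨p, q, -, -, hpq, hp, hq, hobt, -, hu1, hu2, -⟩ := hA.selfPlay_two hj ha h
  by_cases hpε : ε < p
  · refine not_isApproxNash_self (c (j + 1)) ?_
    rw [hobt, hu1]; linarith
  · refine not_isApproxNash_self (c (j + 2)) ?_
    rw [hobt, hu2]
    have : p * (v + 2 * j + 1) ≤ ε * (v + 2 * j + 1) :=
      mul_le_mul_of_nonneg_right (not_lt.1 hpε) (by positivity)
    obtain rfl : q = 1 - p := by linarith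
    linarith

/-- Regrets while only `c j` is played: `c (j + 1)` is still held back by past losses. -/
structure Pure (c : ℕ → ι) (v : ℝ) (j : ℕ) (r : ι → ℝ) : Prop where
  pos : 0 < r (c j)
  le : r (c j) ≤ 2 * j + 1
  nonpos : ∀ i, i ≠ c j → r i ≤ 0
  debt : v * r (c (j + 1)) + r (c (j + 2)) ≤ -(v * (v / 2) ^ j)

/-- Regrets while `c j` and `c (j + 1)` are mixed, and `c (j + 2)` is in debt. -/
structure Mixed (c : ℕ → ι) (v : ℝ) (j : ℕ) (r : ι → ℝ) : Prop where
  pos : 0 < r (c j)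
  pos' : 0 < r (c (j + 1))
  nonpos : ∀ i, i ≠ c j → i ≠ c (j + 1) → r i ≤ 0
  energy : r (c j) ^ 2 + r (c j) + r (c (j + 1)) ^ 2 - r (c (j + 1)) ≤ (2 * j + 1) * (2 * j + 2)
  debt : r (c (j + 2)) ≤ -(v * (v / 2) ^ j) + (r (c (j + 1)) - r (c j)) + (2 * j + 1)

/-- Each round adds `v - (v + 2 * j) ≤ 0` to the combination in `debt`. The stage turns mixed when
the regret of `c (j + 1)` becomes positive. -/
theorem Pure.selfPlay (hA : IsStaircase A c v L) (hv : 0 ≤ v) {s : State ι} {j : ℕ}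
    (hj : j + 2 < L) (hs : Pure c v j s.regret) :
    Pure c v j (s.selfPlay A).regret ∨ Mixed c v j (s.selfPlay A).regret := by
  have n01 := hA.ne (i := j) (j := j + 1) (by omega) (by omega) (by omega)
  have n02 := hA.ne (i := j) (j := j + 2) (by omega) (by omega) (by omega)
  have n12 := hA.ne (i := j + 1) (j := j + 2) (by omega) (by omega) (by omega)
  have hnp : ∀ i, i ≠ c j → i ≠ c (j + 1) → s.regret i ≤ 0 := fun i hi _ => hs.nonpos i hi
  have hle := fun i => hA.selfPlay_regret_le hj hs.pos hnp (i := i)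
  obtain ⟨p, q, -, hqe, hpq, -, -, hobt, hu0, hu1, hu2, -⟩ := hA.selfPlay_two hj hs.pos hnp
  have hb := hs.nonpos _ n01.symm
  obtain rfl : q = 0 := by rw [hqe, max_eq_left hb, zero_div]
  set r' := (s.selfPlay A).regret with hr'
  have r0 : r' (c j) = s.regret (c j) := by
    simp only [hr', State.selfPlay, State.observe, hobt, hu0]; ring
  have r1 : r' (c (j + 1)) = s.regret (c (j + 1)) + 1 := by
    simp only [hr', State.selfPlay, State.observe, hobt, hu1]; ring
  have r2 : r' (c (j + 2)) = s.regret (c (j + 2)) - (v + 2 * j) := by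
    simp only [hr', State.selfPlay, State.observe, hobt, hu2]; ring
  have hj0 : (0 : ℝ) ≤ j := j.cast_nonneg
  have hnp' : ∀ i, i ≠ c j → i ≠ c (j + 1) → r' i ≤ 0 := by
    intro i hi0 hi1
    by_cases hi2 : i = c (j + 2)
    · rw [hi2, r2]; linarith [hs.nonpos _ n02.symm]
    · exact (hle i hi1 hi2).trans (hs.nonpos i hi0)
  have hdebt : v * r' (c (j + 1)) + r' (c (j + 2)) ≤ -(v * (v / 2) ^ j) := by
    rw [r1, r2]; linarith [hs.debt]
  by_cases hpos : 0 < r' (c (j + 1))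
  · right
    have ha := hs.pos
    have ha' := hs.le
    refine ⟨by rwa [r0], hpos, hnp', ?_, ?_⟩
    -- The entering regret lies in `(0, 1]`, so its energy term `b ^ 2 - b` is nonpositive, and the
    -- bound `2 * j + 1` on the regret of `c j` gives the rest.
    · have h1 : r' (c (j + 1)) ≤ 1 := by linarith
      rw [r0]
      nlinarith
    · rw [r0]
      nlinarith
  · left
    refine ⟨by rw [r0]; exact hs.pos, by rw [r0]; exact hs.le, fun i hi => ?_, hdebt⟩
    by_cases hi1 : i = c (j + 1)
    · rw [hi1]; exact not_lt.1 hpos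
    · exact hnp' i hi hi1

-- With the other regret positive, the energy bound gives `b ^ 2 - b < (2 * j + 1) * (2 * j + 2)`.
omit [Fintype ι] in
theorem Mixed.le {j : ℕ} {r : ι → ℝ} (hs : Mixed c v j r) : r (c (j + 1)) ≤ 2 * j + 2 := by
  have := hs.energy
  have := hs.pos
  by_contra! h
  nlinarith [(Nat.cast_nonneg j : (0 : ℝ) ≤ j)]

end IsStaircase
end RegretMatching

/-! ### From the uniform start through all stages. -/

namespace RegretMatching

variable {ι : Type*} [Fintype ι]

theorem nextStrategy_zero (x₀ : stdSimplex ℝ ι) :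
    (⟨0, x₀⟩ : State ι).nextStrategy = x₀ := by
  have : nonnegPart (0 : ι → ℝ) = 0 := by funext i; simp [nonnegPart]
  simp [State.nextStrategy, this]

theorem mulVec_uniformStrategy [Nonempty ι] (A : Matrix ι ι ℝ) (i : ι) :
    (A *ᵥ (uniformStrategy ι).1) i = (∑ j, A i j) / Fintype.card ι := by
  have : (uniformStrategy ι).1 = fun _ => (Fintype.card ι : ℝ)⁻¹ := by
    funext i; exact stdSimplex.barycenter_apply i
  simp [Matrix.mulVec, dotProduct, this, Finset.sum_mul, div_eq_mul_inv]

theorem uniformStrategy_dotProduct [Nonempty ι] (u : ι → ℝ) :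
    (uniformStrategy ι).1 ⬝ᵥ u = (∑ j, u j) / Fintype.card ι := by
  have : (uniformStrategy ι).1 = fun _ => (Fintype.card ι : ℝ)⁻¹ := by
    funext i; exact stdSimplex.barycenter_apply i
  simp [dotProduct, this, Finset.mul_sum, div_eq_inv_mul]

namespace IsStaircase

variable {A : Matrix ι ι ℝ} {c : ℕ → ι} {v : ℝ} {L : ℕ}

/-- The difference of the two positive regrets grows by `p + q = 1` each round, so it counts rounds,
and `c (j + 2)` regains at most `q ≤ 1` per round. The energy bounds this difference, so at least
half of the debt `v * (v / 2) ^ j` survives when `c j` drops out. -/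
theorem Mixed.selfPlay (hA : IsStaircase A c v L) {s : State ι} {j : ℕ}
    (hj : j + 3 < L) (hv : 4 * j + 5 ≤ v / 2) (hs : Mixed c v j s.regret) :
    Mixed c v j (s.selfPlay A).regret ∨ Pure c v (j + 1) (s.selfPlay A).regret ∧
      (s.selfPlay A).regret (c (j + 2)) ≤ -(v / 2) ^ (j + 1) := by
  have n01 := hA.ne (i := j) (j := j + 1) (by omega) (by omega) (by omega)
  have n02 := hA.ne (i := j) (j := j + 2) (by omega) (by omega) (by omega)
  have n12 := hA.ne (i := j + 1) (j := j + 2) (by omega) (by omega) (by omega)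
  have n13 := hA.ne (i := j + 1) (j := j + 3) (by omega) (by omega) (by omega)
  have n03 := hA.ne (i := j) (j := j + 3) (by omega) (by omega) (by omega)
  have hle := fun i => hA.selfPlay_regret_le (by omega) hs.pos hs.nonpos (i := i)
  obtain ⟨p, q, hpe, hqe, hpq, hp, hq, hobt, hu0, hu1, hu2, -⟩ :=
    hA.selfPlay_two (by omega) hs.pos hs.nonpos
  have ha := hs.pos
  have hb := hs.pos'
  have hble := hs.le
  have hF := hs.energy
  have hd := hs.debt
  rw [max_eq_right hb.le] at hpe hqe
  set r' := (s.selfPlay A).regret with hr'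
  have r0 : r' (c j) = s.regret (c j) - q := by
    simp only [hr', State.selfPlay, State.observe, hobt, hu0]; ring
  have r1 : r' (c (j + 1)) = s.regret (c (j + 1)) + p := by
    simp only [hr', State.selfPlay, State.observe, hobt, hu1]; linarith
  have r2 : r' (c (j + 2)) = s.regret (c (j + 2)) + q - p * (v + 2 * j) := by
    simp only [hr', State.selfPlay, State.observe, hobt, hu2]
    obtain rfl : p = 1 - q := by linarith
    ring
  generalize s.regret (c j) = a at *
  generalize s.regret (c (j + 1)) = b at *
  -- Play proportional to regret cancels the first-order change of the energy; what remains is `p ^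
  -- 2 - p + q ^ 2 - q ≤ 0`.
  have hcross : a * q = b * p := by rw [hpe, hqe]; ring
  have hj0 : (0 : ℝ) ≤ j := j.cast_nonneg
  have hF' : r' (c j) ^ 2 + r' (c j) + r' (c (j + 1)) ^ 2 - r' (c (j + 1)) ≤
      (2 * j + 1) * (2 * j + 2) := by
    rw [r0, r1]
    nlinarith
  have hd' : r' (c (j + 2)) ≤
      -(v * (v / 2) ^ j) + (r' (c (j + 1)) - r' (c j)) + (2 * j + 1) := by
    rw [r0, r1, r2]
    have : 0 ≤ p * (v + 2 * j) := mul_nonneg hp (by linarith)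
    linarith
  have hG : (1 : ℝ) ≤ (v / 2) ^ j := one_le_pow₀ (by linarith)
  have hd'' : r' (c (j + 2)) ≤ -(v / 2) ^ (j + 1) := by
    -- The total regained is at most `4 * j + 4`, less than half of the debt.
    have h1 : (4 * j + 5 : ℝ) ≤ v / 2 * (v / 2) ^ j :=
      hv.trans (le_mul_of_one_le_right (by linarith) hG)
    rw [pow_succ]
    rw [r0, r1] at hd'
    linarith
  have h2 : r' (c (j + 2)) ≤ 0 := hd''.trans (by
    have : 0 ≤ (v / 2) ^ (j + 1) := pow_nonneg (by linarith) _
    linarith)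
  have hnp' : ∀ i, i ≠ c j → i ≠ c (j + 1) → r' i ≤ 0 := by
    intro i hi0 hi1
    by_cases hi2 : i = c (j + 2)
    · rwa [hi2]
    · exact (hle i hi1 hi2).trans (hs.nonpos i hi0 hi1)
  by_cases hpos : 0 < r' (c j)
  · exact .inl ⟨hpos, by rw [r1]; linarith, hnp', hF', hd'⟩
  · refine .inr ⟨⟨by rw [r1]; linarith, by rw [r1]; push_cast; linarith, fun i hi => ?_, ?_⟩, hd''⟩
    · by_cases hi0 : i = c j
      · rw [hi0]; exact not_lt.1 hpos
      · exact hnp' i hi0 hi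
    · have h3 := hnp' _ n03.symm n13.symm
      have h4 := mul_le_mul_of_nonneg_left hd'' (by linarith : (0 : ℝ) ≤ v)
      change v * r' (c (j + 2)) + r' (c (j + 3)) ≤ _
      linarith

variable [Nonempty ι] [DecidableEq ι]

/-- The first two rounds, if the uniform strategy favours only `c 0`. -/
theorem mixed_two (hA : IsStaircase A c v L) (hL : 2 < L) (hv : 2 ≤ v)
    (hN : v ≤ Fintype.card ι) (hrow : ∀ i, ∑ j, A i j = if i = c 0 then v else 0) {ε : ℝ}
    (hε : ε ≤ 1 / (Fintype.card ι + 1 : ℝ)) :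
    ¬ IsApproxNash A ε (uniformStrategy ι) (uniformStrategy ι) ∧
    (let s := State.selfPlay A ⟨0, uniformStrategy ι⟩
    0 < s.regret (c 0) ∧ (∀ i, i ≠ c 0 → s.regret i ≤ 0) ∧
    Mixed c v 0 (s.selfPlay A).regret) := by
  set N : ℝ := (Fintype.card ι : ℝ)
  have hN0 : 0 < N := by linarith
  have hu : ∀ i, (A *ᵥ (uniformStrategy ι).1) i = if i = c 0 then v / N else 0 := by
    intro i
    rw [mulVec_uniformStrategy, hrow, ite_div, zero_div]
  have hobt : (uniformStrategy ι).1 ⬝ᵥ (A *ᵥ (uniformStrategy ι).1) = v / N / N := by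
    rw [uniformStrategy_dotProduct]
    simp [hu, N]
  have hvN0 : 0 < v / N := by positivity
  have hvN1 : v / N ≤ 1 := (div_le_one hN0).2 hN
  have hvNN0 : 0 < v / N / N := by positivity
  have hlt : v / N / N ≤ v / N / 2 := by
    gcongr; linarith
  constructor
  · refine not_isApproxNash_self (c 0) ?_
    rw [hobt, hu, if_pos rfl]
    have : 1 / (N + 1) < v / N - v / N / N := by
      have h : v / N - v / N / N = v * (N - 1) / (N * N) := by field_simp
      rw [h, div_lt_div_iff₀ (by positivity) (by positivity)]
      nlinarith
    linarith
  · intro s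
    have hs : ∀ i, s.regret i = (if i = c 0 then v / N else 0) - v / N / N := by
      intro i
      simp only [s, State.selfPlay, State.observe, nextStrategy_zero, hobt, hu]
      simp
    have hs0 : 0 < s.regret (c 0) := by rw [hs, if_pos rfl]; linarith
    have hsn : ∀ i, i ≠ c 0 → s.regret i ≤ 0 := fun i hi => by
      rw [hs, if_neg hi]; linarith
    refine ⟨hs0, hsn, ?_⟩
    have n01 := hA.ne (i := 0) (j := 1) (by omega) (by omega) (by omega)
    have n02 := hA.ne (i := 0) (j := 2) (by omega) (by omega) (by omega)
    have n12 := hA.ne (i := 1) (j := 2) (by omega) (by omega) (by omega)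
    have hnp : ∀ i, i ≠ c 0 → i ≠ c 1 → s.regret i ≤ 0 := fun i hi _ => hsn i hi
    have hle := fun i => hA.selfPlay_regret_le hL hs0 hnp (i := i)
    obtain ⟨p, q, -, hqe, -, -, -, hobt', hu0, hu1, hu2, -⟩ := hA.selfPlay_two hL hs0 hnp
    obtain rfl : q = 0 := by rw [hqe, max_eq_left (hsn _ n01.symm), zero_div]
    set r' := (s.selfPlay A).regret with hr'
    have r0 : r' (c 0) = v / N - v / N / N := by
      simp only [hr', State.selfPlay, State.observe, hobt', hu0, hs, if_true]; ring
    have r1 : r' (c 1) = 1 - v / N / N := by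
      simp only [zero_add] at hu1
      simp only [hr', State.selfPlay, State.observe, hobt', hu1, hs, if_neg n01.symm]; ring
    have r2 : r' (c 2) = - v / N / N - v := by
      simp only [zero_add] at hu2
      simp only [hr', State.selfPlay, State.observe, hobt', hu2, hs, if_neg n02.symm]
      push_cast; ring
    refine ⟨by rw [r0]; linarith, ?_, fun i hi0 hi1 => ?_, ?_, ?_⟩
    -- `c 1` owes less than 1 after the uniform round, so a single pure round suffices and stage 0
    -- is already mixed.
    · change 0 < r' (c 1); rw [r1]; linarith
    · by_cases hi2 : i = c 2
      · rw [hi2, r2, neg_div, neg_div]; linarith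
      · exact (hle i hi1 hi2).trans (hsn i hi0)
    · change _ + r' (c 1) ^ 2 - r' (c 1) ≤ _
      rw [r0, r1]; push_cast; nlinarith
    · change r' (c 2) ≤ _ + (r' (c 1) - _) + _
      rw [r0, r1, r2, neg_div, neg_div]; push_cast; simp only [pow_zero]; linarith

theorem exists_stage {n : ℕ} (hA : IsStaircase A c v (n + 3)) (hn : 0 < n) (hv : 4 * n + 1 ≤ v / 2)
    (hN : v ≤ Fintype.card ι) (hrow : ∀ i, ∑ j, A i j = if i = c 0 then v else 0) {B : ℝ}
    (hB : ∀ i j, |A i j| ≤ B) (t : ℕ) (ht : 2 * B * (t + 2 : ℕ) < (v / 2) ^ n) :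
    ∃ j < n, Pure c v j ((State.selfPlay A)^[t + 2] ⟨0, uniformStrategy ι⟩).regret ∨
      Mixed c v j ((State.selfPlay A)^[t + 2] ⟨0, uniformStrategy ι⟩).regret := by
  have hB0 : 0 ≤ B := (abs_nonneg _).trans (hB (c 0) (c 0))
  have hn1 : (1 : ℝ) ≤ n := by exact_mod_cast hn
  induction t with
  | zero =>
    exact ⟨0, hn, .inr (hA.mixed_two (by omega) (by linarith) hN hrow le_rfl).2.2.2⟩
  | succ t ih =>
    obtain ⟨j, hj, h⟩ := ih (lt_of_le_of_lt
      (mul_le_mul_of_nonneg_left (by exact_mod_cast (by omega)) (by positivity)) ht)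
    -- Leaving the last stage `n - 1` would put `c (n + 1)` in debt `(v / 2) ^ n`, too much for the
    -- elapsed time.
    have hlow := le_regret_iterate_selfPlay hB (uniformStrategy ι) (t + 1 + 2) (c (n + 1))
    rw [show t + 1 + 2 = t + 2 + 1 by omega, Function.iterate_succ_apply'] at hlow ⊢
    rcases h with h | h
    · exact ⟨j, hj, h.selfPlay hA (by linarith) (by omega)⟩
    · have hjn : (j + 1 : ℝ) ≤ n := by exact_mod_cast hj
      rcases h.selfPlay hA (by omega) (by linarith) with h | ⟨h, hd⟩
      · exact ⟨j, hj, .inr h⟩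
      · rcases Nat.lt_or_ge (j + 1) n with hjn | hjn
        · exact ⟨j + 1, hjn, .inl h⟩
        · obtain rfl : n = j + 1 := by omega
          exfalso
          rw [show t + 1 + 2 = t + 2 + 1 by omega] at ht
          exact absurd (hlow.trans hd) (by linarith)

theorem not_isApproxNash_rowStrategy {n : ℕ} (hA : IsStaircase A c v (n + 3)) (hsymm : Aᵀ = A)
    (hn : 0 < n) (hv : 4 * n + 1 ≤ v / 2) (hN : v + 2 * n + 1 ≤ Fintype.card ι)
    (hrow : ∀ i, ∑ j, A i j = if i = c 0 then v else 0) {B : ℝ}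
    (hB : ∀ i j, |A i j| ≤ B) (t : ℕ) (ht1 : 1 ≤ t) (ht : 2 * B * t < (v / 2) ^ n) :
    ¬ IsApproxNash A (1 / (Fintype.card ι + 1 : ℝ))
      (rowStrategy A (uniformStrategy ι) (uniformStrategy ι) t)
      (colStrategy A (uniformStrategy ι) (uniformStrategy ι) t) := by
  have hB0 : 0 ≤ B := (abs_nonneg _).trans (hB (c 0) (c 0))
  have hn1 : (1 : ℝ) ≤ n := by exact_mod_cast hn
  have hinit := hA.mixed_two (by omega) (by linarith) (by linarith) hrow le_rfl
  have hε : ∀ j : ℕ, j < n → 1 / (Fintype.card ι + 1 : ℝ) * (v + 2 * j + 2) < 1 := by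
    intro j hj
    have : (j + 1 : ℝ) ≤ n := by exact_mod_cast hj
    rw [one_div_mul_eq_div, div_lt_one (by linarith)]
    linarith
  -- The profile of round `t` is computed from the regrets after `t - 1` rounds.
  obtain ⟨t, rfl⟩ : ∃ u, t = u + 1 := ⟨t - 1, by omega⟩
  rw [rowStrategy, colStrategy, simultaneousRM_of_isSymm hsymm, Function.iterate_succ_apply']
  simp only [State.selfPlay, State.observe]
  obtain rfl | rfl | ⟨t, rfl⟩ : t = 0 ∨ t = 1 ∨ ∃ u, t = u + 2 := by
    rcases t with - | - | u
    exacts [.inl rfl, .inr (.inl rfl), .inr (.inr ⟨u, rfl⟩)]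
  · simp only [Function.iterate_zero, id, nextStrategy_zero]
    exact hinit.1
  · exact hA.not_isApproxNash (s := State.selfPlay A ⟨0, uniformStrategy ι⟩) (by linarith)
      (by omega) hinit.2.1 (fun i hi _ => hinit.2.2.1 i hi) (hε 0 hn)
  · obtain ⟨j, hj, h | h⟩ := hA.exists_stage hn hv (by linarith) hrow hB t
      (lt_of_le_of_lt (mul_le_mul_of_nonneg_left (by exact_mod_cast Nat.le_succ _)
        (by positivity)) ht)
    · exact hA.not_isApproxNash (by linarith) (by omega) h.pos
        (fun i hi _ => h.nonpos i hi) (hε j hj)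
    · exact hA.not_isApproxNash (by linarith) (by omega) h.pos h.nonpos (hε j hj)

end IsStaircase
end RegretMatching

/-! ### Construction of the game. -/

namespace RegretMatching

section Balanced

variable {ι : Type*} [Fintype ι]

/-- The symmetric matrix `Q`, corrected by multiples of the weights `h` to have zero row sums. -/
def balanced (Q : Matrix ι ι ℝ) (h : ι → ℝ) : Matrix ι ι ℝ := fun i j =>
  Q i j - (∑ l, Q i l) * h j - h i * (∑ l, Q j l) + (∑ k, ∑ l, Q k l) * h i * h j

variable {Q : Matrix ι ι ℝ} {h : ι → ℝ}

theorem sum_balanced (hh : ∑ i, h i = 1) (i : ι) : ∑ j, balanced Q h i j = 0 := by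
  simp only [balanced, Finset.sum_add_distrib, Finset.sum_sub_distrib, ← Finset.mul_sum, hh]
  ring

theorem transpose_balanced (hQ : Qᵀ = Q) : (balanced Q h)ᵀ = balanced Q h := by
  ext i j
  have : Q j i = Q i j := congrFun (congrFun hQ i) j
  simp only [Matrix.transpose_apply, balanced, this]
  ring

theorem abs_balanced_le {q η : ℝ} (hQ0 : ∀ i j, 0 ≤ Q i j) (hQ : ∀ i j, Q i j ≤ q)
    (hh0 : ∀ i, 0 ≤ h i) (hh : ∀ i, Fintype.card ι * h i ≤ η) (i j : ι) :
    |balanced Q h i j| ≤ q + 2 * (q * η) + q * η ^ 2 := by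
  set N : ℝ := (Fintype.card ι : ℝ)
  have hq : 0 ≤ q := (hQ0 i j).trans (hQ i j)
  have hR0 : ∀ i, 0 ≤ ∑ l, Q i l := fun i => Finset.sum_nonneg fun l _ => hQ0 i l
  have hR : ∀ i, ∑ l, Q i l ≤ N * q := fun i => by
    calc ∑ l, Q i l ≤ ∑ _l : ι, q := Finset.sum_le_sum fun l _ => hQ i l
      _ = N * q := by simp [N]
  have hS0 : 0 ≤ ∑ k, ∑ l, Q k l := Finset.sum_nonneg fun k _ => hR0 k
  have hS : ∑ k, ∑ l, Q k l ≤ N * (N * q) := by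
    calc ∑ k, ∑ l, Q k l ≤ ∑ _k : ι, N * q := Finset.sum_le_sum fun k _ => hR k
      _ = N * (N * q) := by simp [N]
  have hRh : ∀ i j, (∑ l, Q i l) * h j ≤ q * η := fun i j => by
    calc (∑ l, Q i l) * h j ≤ (N * q) * h j := mul_le_mul_of_nonneg_right (hR i) (hh0 j)
      _ = q * (N * h j) := by ring
      _ ≤ q * η := mul_le_mul_of_nonneg_left (hh j) hq
  have hSh : (∑ k, ∑ l, Q k l) * h i * h j ≤ q * η ^ 2 := by
    calc (∑ k, ∑ l, Q k l) * h i * h j ≤ N * (N * q) * h i * h j := by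
          gcongr
          · exact hh0 j
          · exact hh0 i
      _ = q * ((N * h i) * (N * h j)) := by ring
      _ ≤ q * η ^ 2 := by
          rw [sq]
          have hN : 0 ≤ N := Nat.cast_nonneg _
          exact mul_le_mul_of_nonneg_left (mul_le_mul (hh i) (hh j) (mul_nonneg hN (hh0 j))
            ((mul_nonneg hN (hh0 i)).trans (hh i))) hq
  have h1 := hRh i j
  have h2 := hRh j i
  have h1' := mul_nonneg (hR0 i) (hh0 j)
  have h2' := mul_nonneg (hR0 j) (hh0 i)
  have h3' := mul_nonneg (mul_nonneg hS0 (hh0 i)) (hh0 j)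
  have := hQ0 i j
  have := hQ i j
  rw [abs_le, balanced, mul_comm (h i)]
  constructor <;> linarith

end Balanced

/-- Weights `v + i + j` on the tridiagonal of the first `k` actions, except at `(0, 0)`. -/
def stairs (m k : ℕ) (v : ℝ) : Matrix (Fin m) (Fin m) ℝ := fun i j =>
  if i.1 < k ∧ j.1 < k ∧ i.1 ≤ j.1 + 1 ∧ j.1 ≤ i.1 + 1 ∧ i.1 + j.1 ≠ 0
  then v + i.1 + j.1 else 0

/-- The uniform distribution on the actions from `k` on. -/
noncomputable def spare (m k : ℕ) : Fin m → ℝ := fun i => if i.1 < k then 0 else ((m : ℝ) - k)⁻¹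

theorem sum_spare {m k : ℕ} (hk : k < m) : ∑ i, spare m k i = 1 := by
  have hk' : (k : ℝ) < m := by exact_mod_cast hk
  have : ∑ i, spare m k i = ∑ i ∈ Finset.range m, if i < k then (0 : ℝ) else ((m : ℝ) - k)⁻¹ :=
    (Finset.sum_range fun i => if i < k then (0 : ℝ) else ((m : ℝ) - k)⁻¹).symm
  rw [this, ← Finset.sum_range_add_sum_Ico _ hk.le, Finset.sum_eq_zero, zero_add,
    Finset.sum_congr rfl (g := fun _ => ((m : ℝ) - k)⁻¹)]
  · rw [Finset.sum_const, Nat.card_Ico, nsmul_eq_mul, Nat.cast_sub hk.le]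
    exact mul_inv_cancel₀ (by linarith)
  · intro i hi
    rw [if_neg (by have := Finset.mem_Ico.1 hi; omega)]
  · intro i hi
    rw [if_pos (Finset.mem_range.1 hi)]

theorem transpose_stairs (m k : ℕ) (v : ℝ) : (stairs m k v)ᵀ = stairs m k v := by
  ext i j
  simp only [Matrix.transpose_apply, stairs]
  split_ifs <;> first | omega | ring

/-- The hard game. -/
noncomputable def stairsGame (m k : ℕ) [NeZero m] (v : ℝ) : Matrix (Fin m) (Fin m) ℝ :=
  balanced (stairs m k v) (spare m k) + Matrix.single 0 0 v

section stairsGame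

variable {m k : ℕ} [NeZero m] {v : ℝ}

theorem transpose_stairsGame : (stairsGame m k v)ᵀ = stairsGame m k v := by
  simp [stairsGame, transpose_balanced (transpose_stairs m k v)]

/-- Entry `(0, 0)` is left out of the balancing and added afterwards, so it alone contributes to the
row sums. -/
theorem sum_stairsGame (hk : k < m) (i : Fin m) :
    ∑ j, stairsGame m k v i j = if i = 0 then v else 0 := by
  simp only [stairsGame, Matrix.add_apply, Finset.sum_add_distrib,
    sum_balanced (sum_spare hk), zero_add, Matrix.single_apply]
  by_cases hi : i = 0
  · simp [hi]
  · simp [hi, Ne.symm hi]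

omit [NeZero m] in
theorem stairs_nonneg (hv : 0 ≤ v) (i j : Fin m) : 0 ≤ stairs m k v i j := by
  unfold stairs; split_ifs <;> positivity

omit [NeZero m] in
theorem stairs_le (hv : 0 ≤ v) (i j : Fin m) : stairs m k v i j ≤ v + 2 * k := by
  unfold stairs
  split_ifs with h
  · have h1 : (i.1 : ℝ) ≤ k := by exact_mod_cast h.1.le
    have h2 : (j.1 : ℝ) ≤ k := by exact_mod_cast h.2.1.le
    linarith
  · positivity

/-- The spare weights vanish on both actions, so every correction term does too. -/
theorem stairsGame_apply_of_lt (i j : Fin m) (hi : i.1 < k) (hj : j.1 < k) :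
    stairsGame m k v i j = if i.1 ≤ j.1 + 1 ∧ j.1 ≤ i.1 + 1 then v + i.1 + j.1 else 0 := by
  simp only [stairsGame, balanced, spare, stairs, Matrix.add_apply, hi, hj, if_true,
    true_and, mul_zero, zero_mul, sub_zero, add_zero, Matrix.single_apply, Fin.ext_iff,
    Fin.val_zero]
  split_ifs with h1 h2 h3 h4 h5 <;> try omega
  · ring
  · have h6 : i.1 = 0 := by omega
    have h7 : j.1 = 0 := by omega
    simp [h6, h7]
  · ring

/-- Only the correction `-h i * (∑ l, Q j l)` survives, so spare actions never tempt against
staircase actions. -/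
theorem stairsGame_apply_of_le (hk : k < m) (hv : 0 ≤ v) (i j : Fin m) (hi : k ≤ i.1)
    (hj : j.1 < k) : stairsGame m k v i j ≤ 0 := by
  have hk' : (k : ℝ) < m := by exact_mod_cast hk
  have h0 : stairs m k v i j = 0 := if_neg (by omega)
  have h1 : Matrix.single (0 : Fin m) (0 : Fin m) v i j = 0 := by
    rw [Matrix.single_apply, if_neg]
    simp only [Fin.ext_iff, Fin.val_zero]
    omega
  have h2 : 0 ≤ spare m k i * ∑ l, stairs m k v j l := by
    refine mul_nonneg ?_ (Finset.sum_nonneg fun l _ => stairs_nonneg hv j l)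
    rw [spare, if_neg (by omega)]
    exact inv_nonneg.2 (by linarith)
  have h3 : spare m k j = 0 := if_pos hj
  simp only [stairsGame, balanced, Matrix.add_apply, h0, h1, h3]
  linarith

theorem isStaircase_stairsGame (hk : k < m) (hv : 0 ≤ v) :
    IsStaircase (stairsGame m k v) (Fin.ofNat m) v k := by
  have hval : ∀ j, j < k → (Fin.ofNat m j).1 = j := fun j hj => Nat.mod_eq_of_lt (by omega)
  have hent : ∀ i j, i < k → j < k → stairsGame m k v (Fin.ofNat m i) (Fin.ofNat m j) =
      if i ≤ j + 1 ∧ j ≤ i + 1 then v + i + j else 0 := fun i j hi hj => by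
    rw [stairsGame_apply_of_lt _ _ (by rwa [hval i hi]) (by rwa [hval j hj]), hval i hi, hval j hj]
  refine ⟨fun i hi j hj hij => ?_, fun j hj => ?_, fun j hj => ?_, fun j hj => ?_, fun j hj => ?_,
    fun j hj i hi => ?_⟩
  · rw [← hval i hi, ← hval j hj, hij]
  · rw [hent _ _ hj hj, if_pos (by omega)]; ring
  · rw [hent _ _ (by omega) hj, if_pos (by omega)]; push_cast; ring
  · rw [hent _ _ hj (by omega), if_pos (by omega)]; push_cast; ring
  · rw [hent _ _ hj (by omega), if_neg (by omega)]
  · rcases Nat.lt_or_ge i.1 k with hik | hik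
    · obtain ⟨l, hl, rfl⟩ : ∃ l, l < k ∧ i = Fin.ofNat m l :=
        ⟨i.1, hik, Fin.ext (Nat.mod_eq_of_lt i.2).symm⟩
      have hne : l ≠ j + 1 := fun h => hi (by rw [h])
      rw [hent _ _ hl (by omega)]
      split_ifs with h
      · have : (l : ℝ) ≤ j := by exact_mod_cast (by omega : l ≤ j)
        linarith
      · positivity
    · exact (stairsGame_apply_of_le hk hv _ _ hik (by rw [hval j (by omega)]; omega)).trans
        (by positivity)

theorem abs_stairsGame_le (hk : 2 * k < m) (hv : 0 ≤ v) (i j : Fin m) :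
    |stairsGame m k v i j| ≤ 9 * (v + 2 * k) + v := by
  have hk' : (2 * k : ℝ) < m := by exact_mod_cast hk
  have hk0 : (0 : ℝ) ≤ k := k.cast_nonneg
  -- At least half of the actions are spare, so `m / (m - k) ≤ 2`.
  have h1 := abs_balanced_le (η := 2) (stairs_nonneg (k := k) hv) (stairs_le hv)
    (h := spare m k) (fun i => ?_) (fun i => ?_) i j
  · have h2 : |Matrix.single (0 : Fin m) (0 : Fin m) v i j| ≤ v := by
      rw [Matrix.single_apply]
      split_ifs
      · rw [abs_of_nonneg hv]
      · rwa [abs_zero]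
    exact (abs_add_le _ _).trans (by linarith)
  · unfold spare
    split_ifs
    · rfl
    · exact inv_nonneg.2 (by linarith)
  · unfold spare
    split_ifs
    · simp
    · rw [Fintype.card_fin, ← div_eq_mul_inv, div_le_iff₀ (by linarith)]
      linarith

end stairsGame

/-! ### Choice of parameters. -/

theorem mul_rpow_le_pow {m n : ℕ} (hn : 9 ≤ n) (h1 : 256 * n ≤ m) (h2 : m < 256 * (n + 1)) :
    2 * (m : ℝ) * (m : ℝ) ^ ((1 / 1024 : ℝ) * m) ≤ (8 * n : ℝ) ^ n := by
  have hn' : (9 : ℝ) ≤ n := by exact_mod_cast hn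
  have h1' : (256 * n : ℝ) ≤ m := by exact_mod_cast h1
  have h2' : (m : ℝ) ≤ 256 * (n + 1) := by exact_mod_cast h2.le
  have hm : (1 : ℝ) ≤ m := by linarith
  have hm0 : (0 : ℝ) < m := by linarith
  calc 2 * (m : ℝ) * (m : ℝ) ^ ((1 / 1024 : ℝ) * m)
      ≤ (m : ℝ) ^ (2 : ℝ) * (m : ℝ) ^ (((n : ℝ) + 1) / 4) := by
        gcongr
        · rw [Real.rpow_two]; nlinarith
        · linarith
    _ = (m : ℝ) ^ (2 + ((n : ℝ) + 1) / 4) := (Real.rpow_add hm0 _ _).symm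
    -- `2 + (n + 1) / 4 ≤ n / 2` is exactly `9 ≤ n`.
    _ ≤ (m : ℝ) ^ ((1 / 2 : ℝ) * n) := Real.rpow_le_rpow_of_exponent_le hm (by linarith)
    _ = (Real.sqrt m) ^ n := by rw [Real.rpow_mul hm0.le, Real.rpow_natCast, Real.sqrt_eq_rpow]
    _ ≤ (8 * n : ℝ) ^ n := by
        gcongr
        rw [Real.sqrt_le_left (by positivity)]
        nlinarith

end RegretMatching

open RegretMatching in
theorem mainTheorem6 :
    ∃ c : ℝ, 0 < c ∧ ∃ m₀ : ℕ, ∀ (m : ℕ) [NeZero m], m₀ ≤ m →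
      ∃ A : Matrix (Fin m) (Fin m) ℝ,
        (∀ i j, |A i j| ≤ (m : ℝ) - 1) ∧
        ∀ t : ℕ, 1 ≤ t → (t : ℝ) < (m : ℝ) ^ (c * (m : ℝ)) →
          ¬ RegretMatching.IsApproxNash A (1 / ((m : ℝ) + 1))
            (RegretMatching.rowStrategy A (RegretMatching.uniformStrategy (Fin m))
              (RegretMatching.uniformStrategy (Fin m)) t)
            (RegretMatching.colStrategy A (RegretMatching.uniformStrategy (Fin m))
              (RegretMatching.uniformStrategy (Fin m)) t) := by
  refine ⟨1 / 1024, by norm_num, 2560, fun m _ hm => ?_⟩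
  -- With `v = 16 * n` and `n + 3` staircase actions, payoffs are at most `9 * (18 * n + 6) + 16 * n
  -- ≤ m - 1`, and debts grow by `v / 2 = 8 * n` per stage.
  obtain ⟨n, hn, h1, h2⟩ : ∃ n : ℕ, 9 ≤ n ∧ 256 * n ≤ m ∧ m < 256 * (n + 1) :=
    ⟨m / 256, by omega, by omega, by omega⟩
  have hn' : (9 : ℝ) ≤ n := by exact_mod_cast hn
  have h1' : (256 * n : ℝ) ≤ m := by exact_mod_cast h1
  have hv : (0 : ℝ) ≤ 16 * n := by positivity
  have hB : ∀ i j, |stairsGame m (n + 3) (16 * n) i j| ≤ (m : ℝ) - 1 := fun i j => by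
    have := abs_stairsGame_le (k := n + 3) (by omega) hv i j
    push_cast at this
    linarith
  refine ⟨stairsGame m (n + 3) (16 * n), hB, fun t ht1 ht => ?_⟩
  have key := (isStaircase_stairsGame (k := n + 3) (by omega) hv).not_isApproxNash_rowStrategy
    transpose_stairsGame (by omega) (by linarith) (by rw [Fintype.card_fin]; linarith)
    (fun i => sum_stairsGame (by omega) i) hB t ht1 ?_
  · rwa [Fintype.card_fin] at key
  · have ht0 : (0 : ℝ) ≤ t := t.cast_nonneg
    calc 2 * ((m : ℝ) - 1) * t ≤ 2 * (m : ℝ) * t := by gcongr; linarith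
      _ < 2 * (m : ℝ) * (m : ℝ) ^ ((1 / 1024 : ℝ) * m) :=
        mul_lt_mul_of_pos_left ht (by linarith)
      _ ≤ (8 * n : ℝ) ^ n := mul_rpow_le_pow hn h1 h2
      _ = (16 * n / 2 : ℝ) ^ n := by ring
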